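/- Theorem 4. Fix a finite-dimensional complex Hilbert space with a reference orthonormal basis, and identify operators with their matrices in it. A state is a positive semidefinite matrix $\rho$ with $\operatorname{Tr}\rho=1$; it is real if all its entries are real, and $\mathcal R$ denotes the set of real states. For states $\rho,\sigma$ let $F(\rho,\sigma)=\operatorname{Tr}\sqrt{\sqrt{\rho}\,\sigma\sqrt{\rho}}$ be the fidelity. Let $\mathrm{Re}(\rho)=\tfrac12(\rho+\rho^*)$, where $\rho^*$ is the entrywise complex conjugate of $\rho$, and put $$M_{\mathrm{Re}}(\rho)=1-F(\rho,\mathrm{Re}(\rho)),\qquad M_{\mathrm g}(\rho)=1-\max_{\sigma\in\mathcal R}F^2(\rho,\sigma)$$ (the geometric imaginarity). A real state $\sigma\in\mathcal R$ is called an optimal real state of $\rho$ for $M_{\mathrm g}$ if it attains this maximum. Then for every state $\rho$ the maximum is attained, and $$M_{\mathrm{Re}}(\rho)\le M_{\mathrm g}(\rho)\le 1-[1-M_{\mathrm{Re}}(\rho)]^2 .$$ Moreover, $M_{\mathrm{Re}}(\rho)=M_{\mathrm g}(\rho)$ if and only if $\rho$ is a real state, and $M_{\mathrm g}(\rho)=1-[1-M_{\mathrm{Re}}(\rho)]^2$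 if and only if $\mathrm{Re}(\rho)$ is an optimal real state of $\rho$ for $M_{\mathrm g}$. -/

import Mathlib

open scoped MatrixOrder ComplexOrder

noncomputable section

namespace Imaginarity

variable {n : Type*} [Fintype n] [DecidableEq n]

/-- A quantum state, as a density matrix in the fixed reference orthonormal basis indexed by `n`:
a positive semidefinite matrix of trace one. -/
def IsState (ρ : Matrix n n ℂ) : Prop :=
  ρ.PosSemidef ∧ ρ.trace = 1

/-- A real state: a quantum state all of whose entries in the reference basis are real numbers. -/
def IsRealState (ρ : Matrix n n ℂ) : Prop :=
  IsState ρ ∧ ∀ i j, (ρ i j).im = 0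

/-- The real part state `(ρ + ρ^*) / 2`, where `ρ^*` is the entrywise complex conjugate of `ρ`
in the reference basis. -/
def rePartState (ρ : Matrix n n ℂ) : Matrix n n ℂ :=
  (1 / 2 : ℂ) • (ρ + ρ.map (starRingEnd ℂ))

/-- The fidelity `Tr √(√ρ σ √ρ)`. The square roots are the positive semidefinite ones; the trace is
a nonnegative real number, read off as a real part. -/
def fidelity (ρ σ : Matrix n n ℂ) : ℝ :=
  (CFC.sqrt (CFC.sqrt ρ * σ * CFC.sqrt ρ)).trace.re

/-- The imaginarity measure `1 - F(ρ, Re ρ)`. -/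
def imagRe (ρ : Matrix n n ℂ) : ℝ :=
  1 - fidelity ρ (rePartState ρ)

/-- The geometric imaginarity: one minus the maximal squared fidelity with a real state. -/
def geomImag (ρ : Matrix n n ℂ) : ℝ :=
  1 - sSup ((fun σ : Matrix n n ℂ => fidelity ρ σ ^ 2) '' {σ | IsRealState σ})

/-- `σ` is an optimal real state of `ρ` for the geometric imaginarity: it is a real state at which
the squared fidelity with `ρ` is maximal among all real states. -/
def IsOptimalRealState (ρ σ : Matrix n n ℂ) : Prop :=
  IsRealState σ ∧ ∀ τ : Matrix n n ℂ, IsRealState τ → fidelity ρ τ ^ 2 ≤ fidelity ρ σ ^ 2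

end Imaginarity

end

namespace Imaginarity

open scoped Matrix Matrix.Norms.L2Operator

/-! ### Entrywise complex conjugation and traces -/

variable {n : Type*}

/-! Everything rests on the chain `F(ρ,σ)² ≤ (1 + F(ρ,ρ*))/2 ≤ F(ρ, Re ρ)` for real `σ`. The left
inequality (`fidelity_sq_le`) is Cauchy–Schwarz: a real `√σ` has the same overlap with a vector
attaining `F(ρ,σ)` and with its conjugate, and the inner product of these two vectors is at most
`F(ρ,ρ*)`. The right one (`fidelity_rePartState_ge`) is concavity of `X ↦ Tr √X` between `√ρ ρ √ρ`
and `√ρ ρ* √ρ`. Concavity is strict, so equality makes these compressions agree, and the unit traces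
then force `ρ = ρ*`. Taking `σ` optimal, which compactness allows, gives the lower bound and its
equality case. The upper bound only tests the maximum at the real state `Re ρ`. -/

lemma conj_eq_transpose {A : Matrix n n ℂ} (hA : A.IsHermitian) :
    A.map (starRingEnd ℂ) = Aᵀ := by
  conv_rhs => rw [← hA.eq]
  rfl

lemma PosSemidef.conj {A : Matrix n n ℂ} (hA : A.PosSemidef) :
    (A.map (starRingEnd ℂ)).PosSemidef := by
  rw [conj_eq_transpose hA.isHermitian]
  exact hA.transpose

lemma conj_conjTranspose (A : Matrix n n ℂ) :
    Aᴴ.map (starRingEnd ℂ) = (A.map (starRingEnd ℂ))ᴴ := rfl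

lemma conj_eq_self {A : Matrix n n ℂ} (h : ∀ i j, (A i j).im = 0) :
    A.map (starRingEnd ℂ) = A := by
  ext i j
  exact Complex.conj_eq_iff_im.mpr (h i j)

lemma rePartState_eq_self {ρ : Matrix n n ℂ} (h : ∀ i j, (ρ i j).im = 0) :
    rePartState ρ = ρ := by
  rw [rePartState, conj_eq_self h, ← two_smul ℂ ρ, smul_smul]
  norm_num

variable [Fintype n]

lemma re_trace_nonneg {A : Matrix n n ℂ} (hA : A.PosSemidef) : 0 ≤ A.trace.re :=
  (Complex.le_def.mp hA.trace_nonneg).1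

lemma eq_zero_of_re_trace_eq_zero {A : Matrix n n ℂ} (hA : A.PosSemidef)
    (h : A.trace.re = 0) : A = 0 :=
  hA.trace_eq_zero_iff.mp (Complex.ext h (Complex.le_def.mp hA.trace_nonneg).2.symm)

lemma re_trace_conjTranspose (A : Matrix n n ℂ) : Aᴴ.trace.re = A.trace.re := by
  rw [Matrix.trace_conjTranspose]; simp

lemma re_trace_mono {A B : Matrix n n ℂ} (h : (B - A).PosSemidef) :
    A.trace.re ≤ B.trace.re := by
  have := re_trace_nonneg h
  rw [Matrix.trace_sub, Complex.sub_re] at this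
  linarith

lemma trace_conj (A : Matrix n n ℂ) :
    (A.map (starRingEnd ℂ)).trace = starRingEnd ℂ A.trace := by
  simp [Matrix.trace]

lemma re_trace_conj (A : Matrix n n ℂ) :
    (A.map (starRingEnd ℂ)).trace.re = A.trace.re := by
  simp [trace_conj]

lemma conj_mul (A B : Matrix n n ℂ) :
    (A * B).map (starRingEnd ℂ) = A.map (starRingEnd ℂ) * B.map (starRingEnd ℂ) :=
  Matrix.map_mul

lemma IsState.conj {ρ : Matrix n n ℂ} (hρ : IsState ρ) : IsState (ρ.map (starRingEnd ℂ)) :=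
  ⟨PosSemidef.conj hρ.1, by rw [trace_conj, hρ.2, map_one]⟩

lemma isRealState_rePartState {ρ : Matrix n n ℂ} (hρ : IsState ρ) :
    IsRealState (rePartState ρ) := by
  refine ⟨⟨(hρ.1.add (PosSemidef.conj hρ.1)).smul ?_, ?_⟩, fun i j ↦ ?_⟩
  · norm_num [Complex.le_def]
  · rw [rePartState, Matrix.trace_smul, Matrix.trace_add, hρ.2, hρ.conj.2]
    norm_num
  · simp [rePartState]

/-- Cauchy–Schwarz for the Hilbert–Schmidt inner product, by expanding `‖X - tB‖² ≥ 0` at the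
projection coefficient `t`. -/
lemma re_trace_mul_sq_le (X B : Matrix n n ℂ) (hB : Bᴴ = B) (hB1 : (B * B).trace.re = 1) :
    (X * B).trace.re ^ 2 ≤ (X * Xᴴ).trace.re := by
  set t := (X * B).trace.re with ht
  have h := re_trace_nonneg (Matrix.posSemidef_self_mul_conjTranspose (X - (t : ℂ) • B))
  have e : (B * Xᴴ).trace.re = t := by
    rw [← re_trace_conjTranspose, Matrix.conjTranspose_mul, hB, Matrix.conjTranspose_conjTranspose]
  simp only [Matrix.conjTranspose_sub, Matrix.conjTranspose_smul, hB, mul_sub, sub_mul,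
    Matrix.smul_mul, Matrix.mul_smul, Matrix.trace_sub, Matrix.trace_smul, smul_eq_mul,
    Complex.sub_re, Complex.star_def, Complex.conj_ofReal, Complex.re_ofReal_mul, e, hB1,
    ← ht] at h
  nlinarith

variable [DecidableEq n]

/-! ### Square roots and the trace norm -/

lemma PosSemidef.sqrt (A : Matrix n n ℂ) : (CFC.sqrt A).PosSemidef :=
  Matrix.nonneg_iff_posSemidef.mp (CFC.sqrt_nonneg A)

lemma conjTranspose_sqrt (A : Matrix n n ℂ) : (CFC.sqrt A)ᴴ = CFC.sqrt A :=
  (PosSemidef.sqrt A).isHermitian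

lemma sqrt_mul_sqrt {A : Matrix n n ℂ} (hA : A.PosSemidef) : CFC.sqrt A * CFC.sqrt A = A :=
  CFC.sqrt_mul_sqrt_self A hA.nonneg

lemma sqrt_eq_of_mul_self {A B : Matrix n n ℂ} (hB : B.PosSemidef) (h : B * B = A) :
    CFC.sqrt A = B :=
  CFC.sqrt_unique h hB.nonneg

/-- A positive semidefinite matrix has a Hermitian pseudo-inverse commuting with it. -/
lemma exists_pseudoinverse {P : Matrix n n ℂ} (hP : P.PosSemidef) :
    ∃ L : Matrix n n ℂ, Lᴴ = L ∧ L * P = P * L ∧ P * L * P = P := by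
  have hs : IsSelfAdjoint P := hP.isHermitian
  have hc (f : ℝ → ℝ) : ContinuousOn f (spectrum ℝ P) := P.finite_real_spectrum.continuousOn f
  have hl : cfc (fun x : ℝ ↦ x⁻¹) P * P = cfc (fun x : ℝ ↦ x⁻¹ * x) P := by
    conv_lhs => enter [2]; rw [← cfc_id' ℝ P]
    rw [← cfc_mul _ _ P (hc _) (hc _)]
  have hr : P * cfc (fun x : ℝ ↦ x⁻¹) P = cfc (fun x : ℝ ↦ x⁻¹ * x) P := by
    conv_lhs => enter [1]; rw [← cfc_id' ℝ P]
    rw [← cfc_mul _ _ P (hc _) (hc _)]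
    simp only [mul_comm]
  -- The convention `0⁻¹ = 0` makes this invert `P` on its support and vanish on its kernel;
  -- continuity is free on a finite spectrum.
  refine ⟨cfc (fun x : ℝ ↦ x⁻¹) P, ?_, hl.trans hr.symm, ?_⟩
  · exact cfc_predicate (R := ℝ) (p := IsSelfAdjoint) (fun x : ℝ ↦ x⁻¹) P
  · rw [hr]
    conv_lhs => enter [2]; rw [← cfc_id' ℝ P]
    rw [← cfc_mul _ _ P (hc _) (hc _)]
    conv_rhs => rw [← cfc_id' ℝ P]
    congr 1; ext x
    by_cases hx : x = 0 <;> simp [hx]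

lemma norm_le_one_iff (K : Matrix n n ℂ) : ‖K‖ ≤ 1 ↔ (1 - Kᴴ * K).PosSemidef := by
  have h0 : 0 ≤ Kᴴ * K := (Matrix.posSemidef_conjTranspose_mul_self K).nonneg
  rw [← Matrix.le_iff, ← CStarAlgebra.norm_le_one_iff_of_nonneg _ h0,
    ← Matrix.star_eq_conjTranspose, CStarRing.norm_star_mul_self]
  constructor <;> intro h <;> nlinarith [norm_nonneg K]

/-- The trace norm of a square matrix. -/
noncomputable def traceNorm (M : Matrix n n ℂ) : ℝ := (CFC.sqrt (Mᴴ * M)).trace.re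

/-- Polar decomposition with `P = |M|` and `K = L Mᴴ`, where `L` is the pseudo-inverse of `P`. Then
`K Kᴴ = P L` is a projection, so `K` is a contraction; no extension to a unitary is needed. -/
lemma exists_contraction_trace_eq (M : Matrix n n ℂ) :
    ∃ K : Matrix n n ℂ, ‖K‖ ≤ 1 ∧ K * M = CFC.sqrt (Mᴴ * M) ∧ Kᴴ * CFC.sqrt (Mᴴ * M) = M := by
  have hM : (Mᴴ * M).PosSemidef := Matrix.posSemidef_conjTranspose_mul_self M
  have hP := PosSemidef.sqrt (Mᴴ * M)
  have hPP := sqrt_mul_sqrt hM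
  set P := CFC.sqrt (Mᴴ * M)
  have hPh : Pᴴ = P := hP.isHermitian
  obtain ⟨L, hLh, hcomm, hPLP⟩ := exists_pseudoinverse hP
  have hQ : (P * L) * (P * L) = P * L := by rw [← mul_assoc, hPLP]
  have hQh : (P * L)ᴴ = P * L := by rw [Matrix.conjTranspose_mul, hLh, hPh, hcomm]
  refine ⟨L * Mᴴ, ?_, ?_, ?_⟩
  · have hle : ‖(L * Mᴴ)ᴴ‖ ≤ 1 := by
      rw [norm_le_one_iff]
      have h1 : (L * Mᴴ)ᴴᴴ * (L * Mᴴ)ᴴ = P * L := by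
        rw [Matrix.conjTranspose_conjTranspose, Matrix.conjTranspose_mul,
          Matrix.conjTranspose_conjTranspose, hLh, mul_assoc, ← mul_assoc Mᴴ, ← hPP, mul_assoc P,
          ← mul_assoc L, hcomm, hQ]
      have h2 : 1 - P * L = (1 - P * L)ᴴ * (1 - P * L) := by
        rw [Matrix.conjTranspose_sub, hQh, Matrix.conjTranspose_one, mul_sub,
          sub_mul _ _ (P * L), hQ]
        simp
      rw [h1, h2]
      exact Matrix.posSemidef_conjTranspose_mul_self _
    rwa [← Matrix.star_eq_conjTranspose, norm_star] at hle
  · rw [mul_assoc, ← hPP, ← mul_assoc, hcomm, hPLP]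
  · rw [Matrix.conjTranspose_mul, Matrix.conjTranspose_conjTranspose, hLh, mul_assoc, hcomm]
    have hPQ : P * (1 - P * L) = 0 := by rw [mul_sub, ← hcomm, ← mul_assoc, hPLP, mul_one, sub_self]
    -- `M` vanishes wherever `P` does, since `Mᴴ M = P²`.
    have h0 : M * (1 - P * L) = 0 := by
      rw [← Matrix.conjTranspose_mul_self_eq_zero, Matrix.conjTranspose_mul, mul_assoc,
        ← mul_assoc Mᴴ, ← hPP, mul_assoc P, hPQ, mul_zero, mul_zero]
    rw [mul_sub, mul_one, sub_eq_zero] at h0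
    exact h0.symm

/-- With `S = √P`, expand `‖ZS - S‖² ≥ 0` in Hilbert–Schmidt norm and use `‖ZS‖² ≤ ‖S‖²`. -/
lemma re_trace_mul_le_of_posSemidef {Z P : Matrix n n ℂ} (hZ : ‖Z‖ ≤ 1) (hP : P.PosSemidef) :
    (Z * P).trace.re ≤ P.trace.re := by
  set S := CFC.sqrt P
  have hS : Sᴴ = S := conjTranspose_sqrt P
  have hSS : S * S = P := sqrt_mul_sqrt hP
  have h1 := re_trace_nonneg (Matrix.posSemidef_conjTranspose_mul_self (Z * S - S))
  have h2 := re_trace_nonneg (((norm_le_one_iff Z).mp hZ).conjTranspose_mul_mul_same S)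
  have e1 : (S * (Zᴴ * S)).trace.re = (Z * P).trace.re := by
    rw [← re_trace_conjTranspose, Matrix.conjTranspose_mul, Matrix.conjTranspose_mul,
      Matrix.conjTranspose_conjTranspose, hS, Matrix.trace_mul_comm, ← mul_assoc, hSS,
      Matrix.trace_mul_comm]
  have e2 : (S * (Z * S)).trace.re = (Z * P).trace.re := by
    rw [Matrix.trace_mul_comm, mul_assoc, hSS]
  simp only [Matrix.conjTranspose_sub, Matrix.conjTranspose_mul, hS, mul_sub, sub_mul,
    Matrix.trace_sub, Complex.sub_re, mul_one, hSS, mul_assoc] at h1 h2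
  rw [e1, e2] at h1
  linarith

lemma re_trace_mul_le_traceNorm {K : Matrix n n ℂ} (hK : ‖K‖ ≤ 1) (M : Matrix n n ℂ) :
    (K * M).trace.re ≤ traceNorm M := by
  obtain ⟨W, hW, -, hWM⟩ := exists_contraction_trace_eq M
  rw [traceNorm]
  conv_lhs => rw [← hWM, ← mul_assoc]
  refine re_trace_mul_le_of_posSemidef ?_ (PosSemidef.sqrt _)
  rw [← Matrix.star_eq_conjTranspose]
  exact (norm_mul_le _ _).trans (mul_le_one₀ hK (norm_nonneg _) (by rwa [norm_star]))

lemma fidelity_eq_traceNorm {ρ σ : Matrix n n ℂ} (hσ : σ.PosSemidef) :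
    fidelity ρ σ = traceNorm (CFC.sqrt σ * CFC.sqrt ρ) := by
  rw [fidelity, traceNorm, Matrix.conjTranspose_mul, conjTranspose_sqrt, conjTranspose_sqrt,
    mul_assoc _ (CFC.sqrt σ), ← mul_assoc (CFC.sqrt σ), sqrt_mul_sqrt hσ, mul_assoc]

lemma norm_conj_le_one {K : Matrix n n ℂ} (hK : ‖K‖ ≤ 1) : ‖K.map (starRingEnd ℂ)‖ ≤ 1 := by
  rw [norm_le_one_iff] at hK ⊢
  have h := PosSemidef.conj hK
  rwa [Matrix.map_sub _ (map_sub _), Matrix.map_one _ (map_zero _) (map_one _), conj_mul,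
    conj_conjTranspose] at h

lemma sqrt_conj {A : Matrix n n ℂ} (hA : A.PosSemidef) :
    CFC.sqrt (A.map (starRingEnd ℂ)) = (CFC.sqrt A).map (starRingEnd ℂ) :=
  sqrt_eq_of_mul_self (PosSemidef.conj (PosSemidef.sqrt A)) (by rw [← conj_mul, sqrt_mul_sqrt hA])

/-! ### The squared fidelity with a real state -/

lemma re_trace_mul_contraction_le {A K : Matrix n n ℂ} (hA : Aᴴ = A) (hK : ‖K‖ ≤ 1) :
    ((A * K) * (A * K)ᴴ).trace.re ≤ (A * A).trace.re := by
  have hK' : ‖Kᴴ‖ ≤ 1 := by rwa [← Matrix.star_eq_conjTranspose, norm_star]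
  have h := re_trace_nonneg (((norm_le_one_iff _).mp hK').mul_mul_conjTranspose_same A)
  simp only [Matrix.conjTranspose_conjTranspose, mul_sub, sub_mul, mul_one, hA, Matrix.trace_sub,
    Complex.sub_re] at h
  simp only [Matrix.conjTranspose_mul, hA, ← mul_assoc] at h ⊢
  linarith

theorem fidelity_sq_le {ρ σ : Matrix n n ℂ} (hρ : IsState ρ) (hσ : IsRealState σ) :
    fidelity ρ σ ^ 2 ≤ (1 + fidelity ρ (ρ.map (starRingEnd ℂ))) / 2 := by
  have hF := fidelity_eq_traceNorm (ρ := ρ) hσ.1.1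
  have hG := fidelity_eq_traceNorm (ρ := ρ) (PosSemidef.conj hρ.1)
  rw [sqrt_conj hρ.1] at hG
  obtain ⟨K, hK, hKM, -⟩ := exists_contraction_trace_eq (CFC.sqrt σ * CFC.sqrt ρ)
  have hAA := sqrt_mul_sqrt hρ.1
  have hBB := sqrt_mul_sqrt hσ.1.1
  have hBc : (CFC.sqrt σ).map (starRingEnd ℂ) = CFC.sqrt σ := by
    rw [← sqrt_conj hσ.1.1, conj_eq_self hσ.2]
  have hAh := conjTranspose_sqrt ρ
  have hBh := conjTranspose_sqrt σ
  rw [traceNorm, ← hKM] at hF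
  set A := CFC.sqrt ρ
  set B := CFC.sqrt σ
  set A' := A.map (starRingEnd ℂ)
  set K' := K.map (starRingEnd ℂ)
  have hA'h : A'ᴴ = A' := by rw [← conj_conjTranspose, hAh]
  have hA1 : (A * A).trace.re = 1 := by rw [hAA, hρ.2]; simp
  have hA'1 : (A' * A').trace.re = 1 := by rw [← conj_mul, re_trace_conj, hA1]
  have h1 : ((A * K) * B).trace.re = fidelity ρ σ := by
    rw [hF, ← Matrix.trace_mul_cycle, mul_assoc]
  have h2 : ((A' * K') * B).trace.re = fidelity ρ σ := by
    rw [← h1, ← re_trace_conj ((A * K) * B), conj_mul, conj_mul, hBc]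
  -- Both summands have overlap `F(ρ,σ)` with `B`, each has squared norm at most 1, and each cross
  -- term is at most `F(ρ,ρ*)`. Hence `4F(ρ,σ)² ≤ 2 + 2F(ρ,ρ*)`.
  have hcs := re_trace_mul_sq_le (A * K + A' * K') B hBh (by rw [hBB, hσ.1.2]; simp)
  rw [add_mul, Matrix.trace_add, Complex.add_re, h1, h2] at hcs
  have n1 := re_trace_mul_contraction_le hAh hK
  have n2 := re_trace_mul_contraction_le hA'h (norm_conj_le_one hK)
  have hKK : ‖K * K'ᴴ‖ ≤ 1 := by
    rw [← Matrix.star_eq_conjTranspose]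
    exact (norm_mul_le _ _).trans
      (mul_le_one₀ hK (norm_nonneg _) (by rw [norm_star]; exact norm_conj_le_one hK))
  have c1 : ((A * K) * (A' * K')ᴴ).trace.re ≤ fidelity ρ (ρ.map (starRingEnd ℂ)) := by
    rw [hG]
    refine le_of_eq_of_le ?_ (re_trace_mul_le_traceNorm hKK _)
    rw [Matrix.conjTranspose_mul, hA'h, mul_assoc A, Matrix.trace_mul_comm]
    simp only [mul_assoc]
  have c2 : ((A' * K') * (A * K)ᴴ).trace.re = ((A * K) * (A' * K')ᴴ).trace.re := by
    rw [← re_trace_conjTranspose, Matrix.conjTranspose_mul, Matrix.conjTranspose_conjTranspose]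
  rw [Matrix.conjTranspose_add, add_mul, mul_add, mul_add] at hcs
  simp only [Matrix.trace_add, Complex.add_re] at hcs
  nlinarith

/-! ### Strict concavity of the trace of the square root -/

/-- With `S = √X` and `T = √Y`, `(X+Y)/2 = ((S+T)/2)² + ((S-T)/2)²`, so operator monotonicity of the
square root gives `√((X+Y)/2) ≥ (S+T)/2`. Equal traces make this an equality of matrices, and the
leftover square forces `S = T`. -/
lemma trace_sqrt_concave {X Y : Matrix n n ℂ} (hX : X.PosSemidef) (hY : Y.PosSemidef) :
    ((CFC.sqrt X).trace.re + (CFC.sqrt Y).trace.re) / 2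
        ≤ (CFC.sqrt ((1 / 2 : ℂ) • (X + Y))).trace.re ∧
      (((CFC.sqrt X).trace.re + (CFC.sqrt Y).trace.re) / 2
        = (CFC.sqrt ((1 / 2 : ℂ) • (X + Y))).trace.re → X = Y) := by
  have hXX := sqrt_mul_sqrt hX
  have hYY := sqrt_mul_sqrt hY
  have hSh := conjTranspose_sqrt X
  have hTh := conjTranspose_sqrt Y
  have hhalf : (0 : ℂ) ≤ 1 / 2 := by norm_num [Complex.le_def]
  have hM : ((1 / 2 : ℂ) • (CFC.sqrt X + CFC.sqrt Y)).PosSemidef :=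
    ((PosSemidef.sqrt X).add (PosSemidef.sqrt Y)).smul hhalf
  have hR := sqrt_mul_sqrt ((hX.add hY).smul hhalf)
  set S := CFC.sqrt X
  set T := CFC.sqrt Y
  have hid : (1 / 2 : ℂ) • (X + Y) = ((1 / 2 : ℂ) • (S + T)) * ((1 / 2 : ℂ) • (S + T))
      + ((1 / 2 : ℂ) • (S - T))ᴴ * ((1 / 2 : ℂ) • (S - T)) := by
    have hc : (starRingEnd ℂ) (1 / 2 : ℂ) = 1 / 2 := by rw [map_div₀, map_one, map_ofNat]
    rw [Matrix.conjTranspose_smul, Matrix.conjTranspose_sub, hSh, hTh, Complex.star_def, hc,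
      ← hXX, ← hYY]
    simp only [smul_mul_smul_comm, mul_add, add_mul, mul_sub, sub_mul]
    module
  have hle : (CFC.sqrt ((1 / 2 : ℂ) • (X + Y)) - (1 / 2 : ℂ) • (S + T)).PosSemidef := by
    rw [← Matrix.le_iff]
    calc (1 / 2 : ℂ) • (S + T)
        = CFC.sqrt (((1 / 2 : ℂ) • (S + T)) * ((1 / 2 : ℂ) • (S + T))) :=
          (CFC.sqrt_mul_self _ hM.nonneg).symm
      _ ≤ _ := by
          apply CFC.sqrt_le_sqrt
          rw [hid]
          exact le_add_of_nonneg_right (Matrix.posSemidef_conjTranspose_mul_self _).nonneg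
  have htr : ((1 / 2 : ℂ) • (S + T)).trace.re = (S.trace.re + T.trace.re) / 2 := by
    rw [Matrix.trace_smul, Matrix.trace_add, smul_eq_mul,
      show (1 / 2 : ℂ) = ((1 / 2 : ℝ) : ℂ) by push_cast; rfl, Complex.re_ofReal_mul,
      Complex.add_re]
    ring
  refine ⟨htr ▸ re_trace_mono hle, fun h ↦ ?_⟩
  have hz := eq_zero_of_re_trace_eq_zero hle (by
    rw [Matrix.trace_sub, Complex.sub_re, htr, h, sub_self])
  rw [sub_eq_zero.mp hz, hid, left_eq_add, Matrix.conjTranspose_mul_self_eq_zero,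
    smul_eq_zero, sub_eq_zero] at hR
  rw [← hXX, ← hYY, hR.resolve_left (by norm_num)]

lemma sqrt_conj_self {ρ : Matrix n n ℂ} (hρ : ρ.PosSemidef) :
    CFC.sqrt (CFC.sqrt ρ * ρ * CFC.sqrt ρ) = ρ := by
  refine sqrt_eq_of_mul_self hρ ?_
  have h := sqrt_mul_sqrt hρ
  set A := CFC.sqrt ρ
  rw [← h]
  simp only [mul_assoc]

lemma fidelity_self {ρ : Matrix n n ℂ} (hρ : IsState ρ) : fidelity ρ ρ = 1 := by
  rw [fidelity, sqrt_conj_self hρ.1, hρ.2, Complex.one_re]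

/-- If two states have the same compression to the support of the first, they coincide. -/
lemma eq_of_sqrt_mul_mul_sqrt_eq {ρ τ : Matrix n n ℂ} (hρ : IsState ρ) (hτ : IsState τ)
    (h : CFC.sqrt ρ * ρ * CFC.sqrt ρ = CFC.sqrt ρ * τ * CFC.sqrt ρ) : ρ = τ := by
  have hAA := sqrt_mul_sqrt hρ.1
  have hAh := conjTranspose_sqrt ρ
  obtain ⟨L, hLh, hcomm, hALA⟩ := exists_pseudoinverse (PosSemidef.sqrt ρ)
  have hBB := sqrt_mul_sqrt hτ.1
  have hBh := conjTranspose_sqrt τ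
  set A := CFC.sqrt ρ
  set B := CFC.sqrt τ
  have hQh : (A * L)ᴴ = A * L := by rw [Matrix.conjTranspose_mul, hLh, hAh, hcomm]
  have hQQ : (A * L) * (A * L) = A * L := by rw [← mul_assoc, hALA]
  have hQρ : (A * L) * ρ = ρ := by rw [← hAA, ← mul_assoc, hALA]
  have hρQ : ρ * (A * L) = ρ := by rw [← hcomm, ← hAA, mul_assoc, ← mul_assoc A L, hALA]
  have hcompr : ρ = (A * L) * τ * (A * L) := by
    have h1 : (A * L) * ρ * (A * L) = (A * L) * τ * (A * L) := by
      have := congrArg (fun Z ↦ L * Z * L) h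
      simp only [← mul_assoc] at this
      rw [hcomm] at this
      simpa only [mul_assoc] using this
    rw [← h1, hQρ, hρQ]
  set Q := A * L
  have htr : (Q * τ).trace = 1 := by
    rw [← hρ.2, hcompr, Matrix.trace_mul_comm (Q * τ), ← mul_assoc, hQQ]
  -- `Q` projects onto the support of `ρ`. As `Tr Qτ = 1 = Tr τ`, no weight of `τ` lies outside it,
  -- so `τ = QτQ = ρ`.
  have hBQ : B * (1 - Q) = 0 := by
    rw [← Matrix.trace_conjTranspose_mul_self_eq_zero_iff, Matrix.conjTranspose_mul, hBh,
      Matrix.conjTranspose_sub, hQh, Matrix.conjTranspose_one, mul_assoc, ← mul_assoc B, hBB,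
      Matrix.trace_mul_comm, mul_assoc, mul_sub (1 - Q), sub_mul 1 Q Q, hQQ]
    simp only [mul_one, one_mul, sub_self, sub_zero, mul_sub, Matrix.trace_sub, hτ.2,
      Matrix.trace_mul_comm τ Q, htr]
  have hτQ : τ * Q = τ := by
    have := congrArg (B * ·) hBQ
    simp only [← mul_assoc, hBB, mul_sub, mul_one, mul_zero, sub_eq_zero] at this
    exact this.symm
  have hQτ : Q * τ = τ := by
    have := congrArg Matrix.conjTranspose hτQ
    rwa [Matrix.conjTranspose_mul, hQh, hτ.1.isHermitian.eq] at this
  rw [hcompr, hQτ, hτQ]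

/-- The average of the fidelities with `ρ` and `ρ^*` is at most the fidelity with the real part,
with equality only for real `ρ`. -/
theorem fidelity_rePartState_ge {ρ : Matrix n n ℂ} (hρ : IsState ρ) :
    (1 + fidelity ρ (ρ.map (starRingEnd ℂ))) / 2 ≤ fidelity ρ (rePartState ρ) ∧
      ((1 + fidelity ρ (ρ.map (starRingEnd ℂ))) / 2 = fidelity ρ (rePartState ρ) →
        IsRealState ρ) := by
  have hAh := conjTranspose_sqrt ρ
  have hX := hρ.1.conjTranspose_mul_mul_same (CFC.sqrt ρ)
  have hY := (PosSemidef.conj hρ.1).conjTranspose_mul_mul_same (CFC.sqrt ρ)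
  rw [hAh] at hX hY
  have key := trace_sqrt_concave hX hY
  rw [← add_mul, ← mul_add, sqrt_conj_self hρ.1, ← Matrix.smul_mul, ← Matrix.mul_smul, hρ.2,
    Complex.one_re] at key
  refine ⟨key.1, fun h ↦ ⟨hρ, fun i j ↦ ?_⟩⟩
  have := eq_of_sqrt_mul_mul_sqrt_eq hρ hρ.conj (key.2 h)
  exact Complex.conj_eq_iff_im.mp (congrFun (congrFun this i) j).symm

/-! ### Existence of an optimal real state -/

lemma continuousOn_sqrt :
    ContinuousOn (CFC.sqrt : Matrix n n ℂ → Matrix n n ℂ) {A | 0 ≤ A} := by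
  have h : ContinuousOn (fun A : Matrix n n ℂ ↦ cfc NNReal.sqrt A) {A | 0 ≤ A} :=
    ContinuousOn.cfc_nnreal_of_mem_nhdsSet (s := Set.univ) NNReal.sqrt Filter.univ_mem
      continuousOn_id (fun _ h ↦ h) NNReal.continuous_sqrt.continuousOn
  exact h.congr fun A _ ↦ CFC.sqrt_eq_cfc

lemma continuousOn_fidelity (ρ : Matrix n n ℂ) :
    ContinuousOn (fidelity ρ) {σ | σ.PosSemidef} := by
  have h : ContinuousOn (fun σ ↦ CFC.sqrt (CFC.sqrt ρ * σ * CFC.sqrt ρ)) {σ | σ.PosSemidef} := by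
    refine continuousOn_sqrt.comp (by fun_prop) fun σ hσ ↦ ?_
    have := Matrix.PosSemidef.conjTranspose_mul_mul_same hσ (CFC.sqrt ρ)
    rw [conjTranspose_sqrt] at this
    exact this.nonneg
  exact Complex.continuous_re.comp_continuousOn
    ((continuous_id.matrix_trace).comp_continuousOn h)

/-- Real states are the image under `B ↦ Bᴴ B` of a closed subset of the Hilbert–Schmidt unit
sphere, whose entries are bounded by 1. -/
lemma isCompact_setOf_isRealState : IsCompact {σ : Matrix n n ℂ | IsRealState σ} := by
  let C : Set (Matrix n n ℂ) := {B | (Bᴴ * B).trace = 1 ∧ ∀ i j, ((Bᴴ * B) i j).im = 0}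
  have hcont : Continuous fun B : Matrix n n ℂ ↦ Bᴴ * B := by fun_prop
  have hclosed : IsClosed C := by
    have hre : IsClosed (⋂ i, ⋂ j, {B : Matrix n n ℂ | ((Bᴴ * B) i j).im = 0}) :=
      isClosed_iInter fun i ↦ isClosed_iInter fun j ↦
        isClosed_eq (Complex.continuous_im.comp (hcont.matrix_elem i j)) continuous_const
    convert! (isClosed_eq hcont.matrix_trace (continuous_const (y := (1 : ℂ)))).inter hre using 1
    ext B
    simp [C]
  have hbox : IsCompact (Set.univ.pi fun _ : n ↦ Set.univ.pi fun _ : n ↦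
      Metric.closedBall (0 : ℂ) 1) :=
    isCompact_univ_pi fun _ ↦ isCompact_univ_pi fun _ ↦ isCompact_closedBall _ _
  have hC : IsCompact C := by
    refine IsCompact.of_isClosed_subset hbox hclosed fun B hB i _ j _ ↦ ?_
    have hsum : ∑ b, ∑ a, ‖B a b‖ ^ 2 = 1 := by
      have h := congrArg Complex.re hB.1
      simpa [Matrix.trace, Matrix.mul_apply, ← Complex.normSq_eq_conj_mul_self,
        Complex.normSq_eq_norm_sq, ← Complex.ofReal_pow] using h
    have h1 : ‖B i j‖ ^ 2 ≤ 1 := by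
      rw [← hsum]
      exact (Finset.single_le_sum (f := fun a ↦ ‖B a j‖ ^ 2) (fun _ _ ↦ by positivity)
        (Finset.mem_univ i)).trans (Finset.single_le_sum (f := fun b ↦ ∑ a, ‖B a b‖ ^ 2)
          (fun _ _ ↦ by positivity) (Finset.mem_univ j))
    rw [mem_closedBall_zero_iff]
    exact (sq_le_one_iff₀ (norm_nonneg _)).mp h1
  convert hC.image hcont using 1
  ext σ
  constructor
  · intro hσ
    have h : (CFC.sqrt σ)ᴴ * CFC.sqrt σ = σ := by rw [conjTranspose_sqrt, sqrt_mul_sqrt hσ.1.1]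
    exact ⟨CFC.sqrt σ, ⟨by rw [h]; exact hσ.1.2, by rw [h]; exact hσ.2⟩, h⟩
  · rintro ⟨B, hB, rfl⟩
    exact ⟨⟨Matrix.posSemidef_conjTranspose_mul_self B, hB.1⟩, hB.2⟩

theorem exists_isOptimalRealState {ρ : Matrix n n ℂ} (hρ : IsState ρ) :
    ∃ σ, IsOptimalRealState ρ σ := by
  obtain ⟨σ, hσ, hmax⟩ := isCompact_setOf_isRealState.exists_isMaxOn
    ⟨_, isRealState_rePartState hρ⟩
    (((continuousOn_fidelity ρ).mono fun σ (hσ : IsRealState σ) ↦ hσ.1.1).pow 2)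
  exact ⟨σ, hσ, fun τ hτ ↦ hmax hτ⟩

lemma IsOptimalRealState.geomImag_eq {ρ σ : Matrix n n ℂ} (h : IsOptimalRealState ρ σ) :
    geomImag ρ = 1 - fidelity ρ σ ^ 2 := by
  have : IsGreatest ((fun σ : Matrix n n ℂ => fidelity ρ σ ^ 2) '' {σ | IsRealState σ})
      (fidelity ρ σ ^ 2) :=
    ⟨⟨σ, h.1, rfl⟩, by rintro _ ⟨τ, hτ, rfl⟩; exact h.2 τ hτ⟩
  rw [geomImag, this.csSup_eq]

end Imaginarity

theorem theorem4 {n : Type*} [Fintype n] [DecidableEq n]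
    (ρ : Matrix n n ℂ) (hρ : Imaginarity.IsState ρ) :
    (∃ σ : Matrix n n ℂ, Imaginarity.IsOptimalRealState ρ σ) ∧
    Imaginarity.imagRe ρ ≤ Imaginarity.geomImag ρ ∧
    Imaginarity.geomImag ρ ≤ 1 - (1 - Imaginarity.imagRe ρ) ^ 2 ∧
    (Imaginarity.imagRe ρ = Imaginarity.geomImag ρ ↔ Imaginarity.IsRealState ρ) ∧
    (Imaginarity.geomImag ρ = 1 - (1 - Imaginarity.imagRe ρ) ^ 2 ↔
      Imaginarity.IsOptimalRealState ρ (Imaginarity.rePartState ρ)) := by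
  obtain ⟨σ, hσ⟩ := Imaginarity.exists_isOptimalRealState hρ
  have hre := Imaginarity.isRealState_rePartState hρ
  have hub := Imaginarity.fidelity_sq_le hρ hσ.1
  obtain ⟨hlb, hreal⟩ := Imaginarity.fidelity_rePartState_ge hρ
  have hopt := hσ.2 _ hre
  rw [hσ.geomImag_eq, Imaginarity.imagRe]
  -- If the two measures agree, the ends of the chain `hub`, `hlb` coincide, so `hlb` is tight and
  -- `hreal` applies.
  refine ⟨⟨σ, hσ⟩, by linarith, by linarith, ⟨fun h ↦ hreal (by linarith), fun h ↦ ?_⟩,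
    ⟨fun h ↦ ⟨hre, fun τ hτ ↦ (hσ.2 τ hτ).trans (by linarith)⟩, fun h ↦ ?_⟩⟩
  · have h1 := hσ.2 ρ h
    rw [Imaginarity.rePartState_eq_self h.2, Imaginarity.fidelity_self hρ] at *
    linarith
  · linarith [h.2 σ hσ.1]
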